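/- Let $\mathcal X,\mathcal Z$ be finite alphabets and let $(X_i)_{i\in\mathbb Z}$ be a stationary Markov chain with values in $\mathcal X$ that is ergodic in the sense of Markov chain theory, i.e. irreducible and aperiodic on the set of states $x$ with $P(X_0=x)>0$. Let $(Z_i)_{i\in\mathbb Z}$ be obtained by passing $(X_i)$ through a memoryless channel $p_{Z|X}$, that is, $P(X_I=x_I,Z_I=z_I)=P(X_I=x_I)\prod_{i\in I}p_{Z|X}(z_i|x_i)$ for every finite $I\subset\mathbb Z$, and suppose that $p_{Z|X}(z|x)>0$ for all $x\in\mathcal X$, $z\in\mathcal Z$. For $k\ge 0$ define the double-sided mixing coefficient $$\delta_k=\operatorname*{ess\,sup}_{Z_{-\infty}^{-k-1},\,Z_{k+1}^{\infty}}\ \max_{x_0\in\mathcal X,\ z_{-k}^{k}\in\mathcal Z^{2k+1}}\Bigl|P_{X_0|Z_{-k}^{k}}\bigl(x_0\,\big|\,z_{-k}^{k}\bigr)-P_{X_0|(Z_i)_{i\in\mathbb Z}}\bigl(x_0\,\big|\,Z_{-\infty}^{-k-1},z_{-k}^{k},Z_{k+1}^{\infty}\bigr)\Bigr| ,$$ where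 the second term is the conditional distribution of $X_0$ given the whole sequence $(Z_i)_{i\in\mathbb Z}$, evaluated at the sequence that equals $z_{-k}^k$ on $\{-k,\dots,k\}$ and is given by the random observations outside. Then $\delta_k\to0$ exponentially fast: there are constants $C,c>0$ such that $\delta_k\le C e^{-ck}$ for all $k\ge 0$. -/

import Mathlib

open MeasureTheory ProbabilityTheory Filter Topology

namespace DoubleSided

/-- The event that the process `X` agrees with the word `x` at all times in `I`. -/
def agree {Ω A : Type*} (X : ℤ → Ω → A) (I : Finset ℤ) (x : ℤ → A) : Set Ω :=
  {ω | ∀ i ∈ I, X i ω = x i}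

/-- Strict stationarity: the law of the whole path is invariant under all time shifts. -/
def IsStationary {Ω A : Type*} [MeasurableSpace Ω] [MeasurableSpace A]
    (μ : Measure Ω) (X : ℤ → Ω → A) : Prop :=
  ∀ s : ℤ, μ.map (fun ω i => X (i + s) ω) = μ.map (fun ω i => X i ω)

/-- The Markov property of a process on a finite alphabet: conditionally on any past
`X_{t-n}, …, X_t` of positive probability, `X_{t+1}` depends on `X_t` only. -/
def IsMarkov {Ω A : Type*} [MeasurableSpace Ω] (μ : Measure Ω) (X : ℤ → Ω → A) : Prop :=
  ∀ (t : ℤ) (n : ℕ) (x : ℤ → A), μ (agree X (Finset.Icc (t - n) t) x) ≠ 0 →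
    ∀ y : A, (μ[|agree X (Finset.Icc (t - n) t) x]) {ω | X (t + 1) ω = y}
      = (μ[|{ω | X t ω = x t}]) {ω | X (t + 1) ω = y}

/-- The `n`-step transition probability `P(X_n = y | X_0 = x)`
(it is `0` if `P(X_0 = x) = 0`). -/
noncomputable def stepProb {Ω A : Type*} [MeasurableSpace Ω] (μ : Measure Ω)
    (X : ℤ → Ω → A) (n : ℕ) (x y : A) : ENNReal :=
  (μ[|{ω | X 0 ω = x}]) {ω | X n ω = y}

/-- A stationary Markov chain on a finite alphabet that is ergodic in the sense of Markov chain
theory: irreducible and aperiodic. The states of the chain are the letters that are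
taken with positive probability. -/
structure IsErgodicMarkovChain {Ω A : Type*} [MeasurableSpace Ω] [MeasurableSpace A]
    (μ : Measure Ω) (X : ℤ → Ω → A) : Prop where
  measurable : ∀ i, Measurable (X i)
  stationary : IsStationary μ X
  markov : IsMarkov μ X
  irreducible : ∀ x y : A, 0 < μ {ω | X 0 ω = x} → 0 < μ {ω | X 0 ω = y} →
    ∃ n : ℕ, 0 < stepProb μ X n x y
  aperiodic : ∀ x : A, 0 < μ {ω | X 0 ω = x} →
    ∀ d : ℕ, (∀ n : ℕ, 0 < n → 0 < stepProb μ X n x x → d ∣ n) → d = 1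

/-- `Z` is the output of the memoryless channel `W` on input `X`:
`P(X_I = x_I, Z_I = z_I) = P(X_I = x_I) ∏_{i ∈ I} W(z_i | x_i)` for all finite sets `I` of times. -/
structure IsChannelOutput {Ω A B : Type*} [MeasurableSpace Ω] [MeasurableSpace B]
    (μ : Measure Ω) (W : A → PMF B) (X : ℤ → Ω → A) (Z : ℤ → Ω → B) : Prop where
  measurable : ∀ i, Measurable (Z i)
  memoryless : ∀ (I : Finset ℤ) (x : ℤ → A) (z : ℤ → B),
    μ (agree X I x ∩ agree Z I z) = μ (agree X I x) * ∏ i ∈ I, W (x i) (z i)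

/-- The window `{-k, …, k}`. -/
noncomputable abbrev Window (k : ℕ) : Finset ℤ := Finset.Icc (-(k : ℤ)) k

/-- The sequence that equals `z` on the window `{-k, …, k}` and `ζ` outside it. -/
noncomputable def splice {B : Type*} (k : ℕ) (z : Window k → B) (ζ : ℤ → B) : ℤ → B :=
  fun i => if h : i ∈ Window k then z ⟨i, h⟩ else ζ i

/-- `P_{X_0 | Z_{-k}^k}(x | z)`. -/
noncomputable def windowPosterior {Ω A B : Type*} [MeasurableSpace Ω] (μ : Measure Ω)
    (X : ℤ → Ω → A) (Z : ℤ → Ω → B) (k : ℕ) (x : A) (z : Window k → B) : ℝ :=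
  (μ[|{ω | ∀ i : Window k, Z i ω = z i}]).real {ω | X 0 ω = x}

/-- `P_{X_0 | Z}(x | ζ)`, through the regular conditional distribution of `X_0` given the whole
two-sided sequence `Z`. -/
noncomputable def fullPosterior {Ω A B : Type*} [MeasurableSpace Ω]
    [MeasurableSpace A] [StandardBorelSpace A] [Nonempty A] [MeasurableSpace B]
    (μ : Measure Ω) [IsFiniteMeasure μ] (X : ℤ → Ω → A) (Z : ℤ → Ω → B)
    (x : A) (ζ : ℤ → B) : ℝ :=
  (condDistrib (X 0) (fun ω i => Z i ω) μ ζ).real {x}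

/-- The double-sided mixing coefficient `δ_k(X, Z)`: the essential supremum over the observations
outside the window of the maximum, over `x` and over the contents `z` of the window, of
`|P_{X_0 | Z_{-k}^k}(x | z) - P_{X_0 | Z}(x | z, Z_{-∞}^{-k-1}, Z_{k+1}^∞)|`. -/
noncomputable def mixingCoeff {Ω A B : Type*} [MeasurableSpace Ω]
    [MeasurableSpace A] [StandardBorelSpace A] [Nonempty A] [MeasurableSpace B]
    (μ : Measure Ω) [IsFiniteMeasure μ] (X : ℤ → Ω → A) (Z : ℤ → Ω → B) (k : ℕ) : ℝ :=
  essSup (fun ω => ⨆ p : A × (Window k → B),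
    |windowPosterior μ X Z k p.1 p.2
      - fullPosterior μ X Z p.1 (splice k p.2 (fun i => Z i ω))|) μ

end DoubleSided

/-! Grow the window by one step on both sides. Let `v n (a, b)` be the joint probability of `X 0 ∈
D`, of the endpoints `X (-n) = a` and `X n = b`, and of the observations in the window, divided by
the stationary mass of `a`. The division cancels the mass introduced by the backward step, so `v`
obeys a linear recursion (`jointProb_succ`): apply `pairMatrix`, which does not depend on the
observations, then multiply by two emission probabilities. The same recursion holds for `D = {x}`
and for `D = Set.univ`; the ratio of the two solutions is the posterior of `x` given the endpoints
and the window.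

The chain is primitive on its support, and so is `pairMatrix`. Emissions are bounded below, so each
block of `m₀` steps has a kernel with entries in `[δ, 1]`, `δ > 0`, and shrinks the interval
containing these ratios by `1 - δ` (`mulVec_contraction`, `exists_sandwich`). After time `k` the
interval `[m, M]` remains valid whatever is observed outside the window, because nonnegative
recursions preserve such bounds (`sandwich_mono`). Summing over endpoints puts the posteriors given
all larger windows in `[m, M]` (`exists_posterior_sandwich`).

The full posterior is a density, and domination of measures can be tested on cylinders
(`measure_le_of_cyl`), so it lies in `[m, M]` almost everywhere on the cylinder
(`ae_fullPosterior_mem_Icc`). Overwriting the window costs only a bounded factor in probability, so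
this null set stays null for the spliced sequence (`map_splice_absolutelyContinuous`). -/

namespace DoubleSided

/-! ### Positive linear recursions: contraction of ratios, and primitivity -/

section Contraction

variable {ι : Type*} [Fintype ι]

lemma mulVec_sandwich (K : Matrix ι ι ℝ) (hK : ∀ s t, 0 ≤ K s t) {v V : ι → ℝ} {m M : ℝ}
    (h : ∀ s, m * V s ≤ v s ∧ v s ≤ M * V s) (s : ι) :
    m * (K.mulVec V) s ≤ (K.mulVec v) s ∧ (K.mulVec v) s ≤ M * (K.mulVec V) s := by
  simp only [Matrix.mulVec, dotProduct, Finset.mul_sum]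
  constructor <;> refine Finset.sum_le_sum fun t _ => ?_
  · nlinarith [mul_le_mul_of_nonneg_left (h t).1 (hK s t)]
  · nlinarith [mul_le_mul_of_nonneg_left (h t).2 (hK s t)]

/-- A kernel with entries in `[δ, 1]` shrinks the oscillation of the ratio of two
vectors by the factor `1 - δ`. -/
lemma mulVec_contraction (K : Matrix ι ι ℝ) {δ : ℝ} (hδ : 0 ≤ δ) (hK : ∀ s t, δ ≤ K s t)
    (hK1 : ∀ s t, K s t ≤ 1) {v V : ι → ℝ} {m M : ℝ} (hV : ∀ s, 0 ≤ V s)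
    (h : ∀ s, m * V s ≤ v s ∧ v s ≤ M * V s) :
    ∃ m' M', M' - m' = (1 - δ) * (M - m) ∧
      ∀ s, m' * (K.mulVec V) s ≤ (K.mulVec v) s ∧ (K.mulVec v) s ≤ M' * (K.mulVec V) s := by
  have key : ∀ u : ι → ℝ, (∀ s, 0 ≤ u s) → ∀ s, δ * ∑ t, u t ≤ K.mulVec u s := by
    intro u hu s
    simp only [Matrix.mulVec, dotProduct, Finset.mul_sum]
    exact Finset.sum_le_sum fun t _ => mul_le_mul_of_nonneg_right (hK s t) (hu t)
  have hle : ∀ s, K.mulVec V s ≤ ∑ t, V t := by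
    intro s
    simp only [Matrix.mulVec, dotProduct]
    exact Finset.sum_le_sum fun t _ => mul_le_of_le_one_left (hV t) (hK1 s t)
  set T := ∑ t, V t with hT
  have hT0 : 0 ≤ T := Finset.sum_nonneg fun t _ => hV t
  -- `θ` is the `V`-weighted mean of the excess of the ratio `v / V` over `m`. If `T = 0`, division
  -- gives `θ = 0`, which is harmless since `v` and `V` then vanish.
  set θ := (∑ t, (v t - m * V t)) / T with hθ
  have hθT : θ * T = ∑ t, (v t - m * V t) := by
    rcases eq_or_ne T 0 with h0 | h0
    · have hz : ∀ t, V t = 0 := fun t =>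
        (Finset.sum_eq_zero_iff_of_nonneg fun t _ => hV t).1 h0 t (Finset.mem_univ t)
      have hv : ∀ t, v t = 0 := fun t => by
        have := h t
        rw [hz t] at this
        linarith [this.1, this.2]
      simp [h0, hz, hv]
    · rw [hθ, div_mul_cancel₀ _ h0]
  have hθ0 : 0 ≤ θ := div_nonneg (Finset.sum_nonneg fun t _ => by linarith [(h t).1]) hT0
  have hθT' : (M - m - θ) * T = ∑ t, (M * V t - v t) := by
    have : ∑ t, (M * V t - v t) = (M - m) * T - ∑ t, (v t - m * V t) := by
      rw [hT, Finset.mul_sum, ← Finset.sum_sub_distrib]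
      exact Finset.sum_congr rfl fun t _ => by ring
    rw [this, ← hθT]; ring
  have hlin : ∀ (c d : ℝ) s, K.mulVec (fun t => c * v t + d * V t) s
      = c * K.mulVec v s + d * K.mulVec V s := by
    intro c d s
    simp only [Matrix.mulVec, dotProduct, Finset.mul_sum, ← Finset.sum_add_distrib]
    exact Finset.sum_congr rfl fun t _ => by ring
  -- The lower end gains `δ * θ` and the upper end loses `δ * (M - m - θ)`, in total `δ * (M - m)`.
  -- The gains come from `key` for the nonnegative vectors `v - m V` and `M V - v`, compared with `K
  -- V ≤ T`.
  refine ⟨m + δ * θ, M - δ * (M - m - θ), by ring, fun s => ⟨?_, ?_⟩⟩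
  · have h1 := key (fun t => 1 * v t + (-m) * V t) (fun t => by linarith [(h t).1]) s
    rw [hlin] at h1
    have h2 : ∑ t, (1 * v t + (-m) * V t) = θ * T := by
      rw [hθT]; exact Finset.sum_congr rfl fun t _ => by ring
    rw [h2] at h1
    have := mul_le_mul_of_nonneg_left (hle s) (mul_nonneg hδ hθ0)
    linarith
  · have h1 := key (fun t => (-1) * v t + M * V t) (fun t => by linarith [(h t).2]) s
    rw [hlin] at h1
    have h2 : ∑ t, ((-1) * v t + M * V t) = (M - m - θ) * T := by
      rw [hθT']; exact Finset.sum_congr rfl fun t _ => by ring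
    rw [h2] at h1
    -- For `T = 0` the sign of `M - m - θ` is unknown, but then `K V` is zero.
    rcases eq_or_lt_of_le hT0 with h0 | h0
    · have hz : K.mulVec V s = 0 := le_antisymm (h0 ▸ hle s) (by
        simp only [Matrix.mulVec, dotProduct]
        exact Finset.sum_nonneg fun t _ => mul_nonneg (hδ.trans (hK s t)) (hV t))
      rw [hz, ← h0] at h1
      rw [hz]
      linarith
    · have h3 : 0 ≤ M - m - θ := by
        refine nonneg_of_mul_nonneg_left ?_ h0
        rw [hθT']
        exact Finset.sum_nonneg fun t _ => by linarith [(h t).2]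
      have := mul_le_mul_of_nonneg_left (hle s) (mul_nonneg hδ h3)
      linarith

/-- Sandwich bounds between two solutions of the same positive recursion persist. -/
lemma sandwich_mono {P : Matrix ι ι ℝ} (hP : ∀ s t, 0 ≤ P s t) {d : ℕ → ι → ℝ}
    (hd : ∀ k s, 0 ≤ d k s) {v V : ℕ → ι → ℝ}
    (hv : ∀ k s, v (k + 1) s = d k s * (P.mulVec (v k)) s)
    (hV : ∀ k s, V (k + 1) s = d k s * (P.mulVec (V k)) s) {m M : ℝ} {k n : ℕ} (hkn : k ≤ n)
    (h : ∀ s, m * V k s ≤ v k s ∧ v k s ≤ M * V k s) (s : ι) :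
    m * V n s ≤ v n s ∧ v n s ≤ M * V n s := by
  induction n, hkn using Nat.le_induction generalizing s with
  | base => exact h s
  | succ n _ ih =>
    have := mulVec_sandwich P hP ih s
    rw [hv, hV]
    constructor
    · have := mul_le_mul_of_nonneg_left this.1 (hd n s)
      linarith
    · have := mul_le_mul_of_nonneg_left this.2 (hd n s)
      linarith

variable [DecidableEq ι]

/-- The transfer matrix of the `j` steps that follow time `r`. -/
noncomputable def transfer (P : Matrix ι ι ℝ) (d : ℕ → ι → ℝ) (r : ℕ) : ℕ → Matrix ι ι ℝ
  | 0 => 1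
  | j + 1 => Matrix.diagonal (d (r + j)) * P * transfer P d r j

lemma pow_nonneg_entries {P : Matrix ι ι ℝ} (hP : ∀ s t, 0 ≤ P s t) (n : ℕ) (s t : ι) :
    0 ≤ (P ^ n) s t := by
  induction n generalizing s t with
  | zero => rw [pow_zero, Matrix.one_apply]; split_ifs <;> norm_num
  | succ n ih =>
    rw [pow_succ, Matrix.mul_apply]
    exact Finset.sum_nonneg fun u _ => mul_nonneg (ih s u) (hP u t)

/-- An entry of the transfer matrix is a sum over paths of `j` steps, each weighted by `j` factors
from `[w, 1]`. -/
lemma transfer_bounds {P : Matrix ι ι ℝ} (hP : ∀ s t, 0 ≤ P s t) {d : ℕ → ι → ℝ} {w : ℝ}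
    (hw : 0 ≤ w) (hd : ∀ k s, w ≤ d k s) (hd1 : ∀ k s, d k s ≤ 1) (r j : ℕ) (s t : ι) :
    w ^ j * (P ^ j) s t ≤ transfer P d r j s t ∧ transfer P d r j s t ≤ (P ^ j) s t := by
  induction j generalizing s t with
  | zero => simp [transfer]
  | succ j ih =>
    have hpow := pow_nonneg_entries hP j
    rw [transfer, Matrix.mul_assoc, Matrix.diagonal_mul, Matrix.mul_apply, pow_succ' P,
      Matrix.mul_apply, pow_succ']
    have hs : 0 ≤ ∑ u, P s u * (P ^ j) u t :=
      Finset.sum_nonneg fun u _ => mul_nonneg (hP s u) (hpow u t)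
    have h1 : w ^ j * ∑ u, P s u * (P ^ j) u t ≤ ∑ u, P s u * transfer P d r j u t := by
      rw [Finset.mul_sum]
      refine Finset.sum_le_sum fun u _ => ?_
      have := mul_le_mul_of_nonneg_left (ih u t).1 (hP s u)
      linarith
    have h2 : ∑ u, P s u * transfer P d r j u t ≤ ∑ u, P s u * (P ^ j) u t :=
      Finset.sum_le_sum fun u _ => mul_le_mul_of_nonneg_left (ih u t).2 (hP s u)
    have h0 : 0 ≤ w ^ j * ∑ u, P s u * (P ^ j) u t := mul_nonneg (pow_nonneg hw j) hs
    constructor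
    · rw [mul_assoc]
      exact mul_le_mul (hd _ s) h1 h0 (hw.trans (hd _ s))
    · exact (mul_le_of_le_one_left (h0.trans h1) (hd1 _ s)).trans h2

lemma eq_transfer_mulVec {P : Matrix ι ι ℝ} {d : ℕ → ι → ℝ} {v : ℕ → ι → ℝ}
    (hv : ∀ k s, v (k + 1) s = d k s * (P.mulVec (v k)) s) (r j : ℕ) :
    v (r + j) = (transfer P d r j).mulVec (v r) := by
  induction j with
  | zero => simp [transfer]
  | succ j ih =>
    ext s
    rw [← add_assoc, hv, ih, transfer, ← Matrix.mulVec_mulVec, ← Matrix.mulVec_mulVec,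
      Matrix.mulVec_diagonal]

/-- The ratio of two solutions of a positive recursion with a primitive matrix has exponentially
decaying oscillation. -/
theorem exists_sandwich {P : Matrix ι ι ℝ} (hP : ∀ s t, 0 ≤ P s t) {m₀ : ℕ} {q w : ℝ}
    (hq : 0 ≤ q) (hPq : ∀ s t, q ≤ (P ^ m₀) s t) (hP1 : ∀ s t, (P ^ m₀) s t ≤ 1) (hw : 0 ≤ w)
    {d : ℕ → ι → ℝ} (hd : ∀ k s, w ≤ d k s) (hd1 : ∀ k s, d k s ≤ 1) {v V : ℕ → ι → ℝ}
    (hv : ∀ k s, v (k + 1) s = d k s * (P.mulVec (v k)) s)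
    (hV : ∀ k s, V (k + 1) s = d k s * (P.mulVec (V k)) s)
    (h0 : ∀ s, 0 ≤ v 0 s ∧ v 0 s ≤ V 0 s) (k : ℕ) :
    ∃ m M, M - m = (1 - w ^ m₀ * q) ^ (k / m₀) ∧
      ∀ s, m * V k s ≤ v k s ∧ v k s ≤ M * V k s := by
  have hd0 : ∀ k s, 0 ≤ d k s := fun k s => hw.trans (hd k s)
  have hV0 : ∀ k s, 0 ≤ V k s := by
    intro k
    induction k with
    | zero => exact fun s => (h0 s).1.trans (h0 s).2
    | succ k ih =>
      intro s
      rw [hV]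
      exact mul_nonneg (hd0 k s) (Finset.sum_nonneg fun t _ => mul_nonneg (hP s t) (ih t))
  -- Blocks start at time `k % m₀`, so that the last of the `k / m₀` blocks ends exactly at `k`; the
  -- initial interval `[0, 1]` survives until the first block.
  have main : ∀ j, ∃ m M, M - m = (1 - w ^ m₀ * q) ^ j ∧
      ∀ s, m * V (k % m₀ + m₀ * j) s ≤ v (k % m₀ + m₀ * j) s ∧
        v (k % m₀ + m₀ * j) s ≤ M * V (k % m₀ + m₀ * j) s := by
    intro j
    induction j with
    | zero =>
      refine ⟨0, 1, by simp, ?_⟩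
      exact sandwich_mono hP hd0 hv hV (Nat.zero_le _)
        fun s => by simpa using h0 s
    | succ j ih =>
      obtain ⟨m, M, hmM, hb⟩ := ih
      have hδ : 0 ≤ w ^ m₀ * q := mul_nonneg (pow_nonneg hw _) hq
      have hT := transfer_bounds hP hw hd hd1 (k % m₀ + m₀ * j) m₀
      obtain ⟨m', M', h', hb'⟩ := mulVec_contraction (transfer P d (k % m₀ + m₀ * j) m₀) hδ
        (fun s t => (mul_le_mul_of_nonneg_left (hPq s t) (pow_nonneg hw _)).trans (hT s t).1)
        (fun s t => (hT s t).2.trans (hP1 s t)) (hV0 _) hb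
      refine ⟨m', M', by rw [h', hmM, pow_succ'], ?_⟩
      rw [Nat.mul_succ, ← add_assoc, eq_transfer_mulVec hv, eq_transfer_mulVec hV]
      exact hb'
  obtain ⟨m, M, h1, h2⟩ := main (k / m₀)
  rw [Nat.mod_add_div] at h2
  exact ⟨m, M, h1, h2⟩

/-- An irreducible and aperiodic nonnegative matrix is primitive. -/
theorem exists_pow_pos {Q : Matrix ι ι ℝ} (hQ : ∀ s t, 0 ≤ Q s t)
    (hirr : ∀ s t, ∃ n, 0 < (Q ^ n) s t)
    (hap : ∀ s, ∀ d : ℕ, (∀ n : ℕ, 0 < n → 0 < (Q ^ n) s s → d ∣ n) → d = 1) :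
    ∃ m, 0 < m ∧ ∀ s t, 0 < (Q ^ m) s t := by
  have hmul : ∀ a b s t u, 0 < (Q ^ a) s t → 0 < (Q ^ b) t u → 0 < (Q ^ (a + b)) s u := by
    intro a b s t u h1 h2
    rw [pow_add, Matrix.mul_apply]
    exact Finset.sum_pos' (fun x _ => mul_nonneg (pow_nonneg_entries hQ a s x)
      (pow_nonneg_entries hQ b x u)) ⟨t, Finset.mem_univ t, mul_pos h1 h2⟩
  have hdiag : ∀ s, ∃ N, ∀ n ≥ N, 0 < (Q ^ n) s s := by
    intro s
    let R : AddSubmonoid ℕ :=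
      { carrier := {n | 0 < (Q ^ n) s s}
        add_mem' := fun {a b} ha hb => hmul a b s s s ha hb
        zero_mem' := by simp }
    have hg : Nat.setGcd (R : Set ℕ) = 1 :=
      hap s _ fun n _ hn => Nat.setGcd_dvd_of_mem hn
    -- Return times form an additive semigroup of gcd 1, which contains every large integer.
    obtain ⟨N, hN⟩ := Nat.exists_mem_closure_of_ge (s := (R : Set ℕ))
    refine ⟨N, fun n hn => ?_⟩
    have := hN n hn (by rw [hg]; exact one_dvd n)
    rwa [AddSubmonoid.closure_eq] at this
  choose N hN using hdiag
  choose L hL using hirr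
  -- For every pair this exponent leaves at least `N s` steps for loops at `s` before the path of
  -- length `L s t` to `t`.
  refine ⟨(∑ s, N s + ∑ s, ∑ t, L s t) + 1, Nat.succ_pos _, fun s t => ?_⟩
  have h1 : N s ≤ ∑ s, N s := Finset.single_le_sum (fun _ _ => Nat.zero_le _) (Finset.mem_univ s)
  have h2 : L s t ≤ ∑ s, ∑ t, L s t :=
    (Finset.single_le_sum (f := fun t => L s t) (fun _ _ => Nat.zero_le _)
      (Finset.mem_univ t)).trans
      (Finset.single_le_sum (f := fun s => ∑ t, L s t) (fun _ _ => Nat.zero_le _)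
        (Finset.mem_univ s))
  have h3 := hmul _ (L s t) s s t
    (hN s ((∑ s, N s + ∑ s, ∑ t, L s t) + 1 - L s t) (by omega)) (hL s t)
  rwa [Nat.sub_add_cancel (by omega)] at h3

end Contraction

/-! ### Cylinder events and comparison of measures on sequences -/

section Cylinders

lemma measurableSet_agree {Ω A : Type*} [MeasurableSpace Ω] [MeasurableSpace A]
    [MeasurableSingletonClass A] {X : ℤ → Ω → A} (hX : ∀ i, Measurable (X i)) (I : Finset ℤ)
    (x : ℤ → A) : MeasurableSet (agree X I x) := by
  have : agree X I x = ⋂ i ∈ I, X i ⁻¹' {x i} := by ext; simp [agree]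
  rw [this]
  exact I.measurableSet_biInter fun i _ => hX i (measurableSet_singleton _)

lemma measure_eq_sum_inter_fiber {Ω C : Type*} [MeasurableSpace Ω] [Fintype C] [MeasurableSpace C]
    [MeasurableSingletonClass C] (μ : Measure Ω) {f : Ω → C} (hf : Measurable f) (E : Set Ω) :
    μ E = ∑ c, μ (E ∩ f ⁻¹' {c}) := by
  have h := sum_measure_preimage_singleton (μ := μ.restrict E) (f := f) Finset.univ
    fun c _ => hf (measurableSet_singleton c)
  rw [Finset.coe_univ, Set.preimage_univ, Measure.restrict_apply_univ] at h
  rw [← h]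
  refine Finset.sum_congr rfl fun c _ => ?_
  rw [Measure.restrict_apply (hf (measurableSet_singleton c)), Set.inter_comm]

lemma measureReal_eq_sum_inter_fiber {Ω C : Type*} [MeasurableSpace Ω] [Fintype C]
    [MeasurableSpace C] [MeasurableSingletonClass C] (μ : Measure Ω) [IsFiniteMeasure μ]
    {f : Ω → C} (hf : Measurable f) (E : Set Ω) :
    μ.real E = ∑ c, μ.real (E ∩ f ⁻¹' {c}) := by
  rw [measureReal_def, measure_eq_sum_inter_fiber μ hf E,
    ENNReal.toReal_sum fun c _ => measure_ne_top μ _]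
  rfl

/-- An arbitrary extension of a word on `I` to a two-sided sequence. -/
noncomputable def extend {A : Type*} [Nonempty A] {I : Finset ℤ} (c : I → A) : ℤ → A :=
  fun i => if h : i ∈ I then c ⟨i, h⟩ else Classical.arbitrary A

lemma extend_of_mem {A : Type*} [Nonempty A] {I : Finset ℤ} (c : I → A) {i : ℤ} (h : i ∈ I) :
    extend c i = c ⟨i, h⟩ := by simp [extend, h]

lemma preimage_restrict_eq_agree {Ω A : Type*} [Nonempty A] (X : ℤ → Ω → A) (I : Finset ℤ)
    (c : I → A) : (fun ω (i : I) => X i ω) ⁻¹' {c} = agree X I (extend c) := by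
  ext ω
  simp only [Set.mem_preimage, Set.mem_singleton_iff, agree, Set.mem_ofPred_eq]
  constructor
  · rintro h i hi
    rw [extend_of_mem c hi, ← h]
  · intro h
    ext ⟨i, hi⟩
    rw [← extend_of_mem c hi, ← h i hi]

lemma measureReal_eq_sum_agree {Ω A : Type*} [MeasurableSpace Ω] [Fintype A] [Nonempty A]
    [MeasurableSpace A] [MeasurableSingletonClass A] (μ : Measure Ω) [IsFiniteMeasure μ]
    {X : ℤ → Ω → A} (hX : ∀ i, Measurable (X i)) (I : Finset ℤ) (E : Set Ω) :
    μ.real E = ∑ c : I → A, μ.real (E ∩ agree X I (extend c)) := by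
  simp_rw [← preimage_restrict_eq_agree]
  have hf : Measurable fun ω (i : I) => X i ω := measurable_pi_lambda _ fun i => hX i
  exact measureReal_eq_sum_inter_fiber μ hf E

/-- The set of sequences that agree with `w` on the window `{-n, …, n}`. -/
abbrev cyl {B : Type*} (n : ℕ) (w : ℤ → B) : Set (ℤ → B) :=
  agree (fun i (ζ : ℤ → B) => ζ i) (Window n) w

lemma exists_window_superset (s : Finset ℤ) (k : ℕ) : ∃ n, k ≤ n ∧ s ⊆ Window n := by
  refine ⟨k + ∑ i ∈ s, i.natAbs, by omega, fun i hi => ?_⟩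
  have : i.natAbs ≤ ∑ i ∈ s, i.natAbs :=
    Finset.single_le_sum (f := Int.natAbs) (fun _ _ => Nat.zero_le _) hi
  rw [Finset.mem_Icc]
  omega

open scoped symmDiff in
/-- Domination between finite measures on two-sided sequences only has to be checked on the
cylinders over large windows. -/
theorem measure_le_of_cyl {B : Type*} [Fintype B] [Nonempty B] [MeasurableSpace B]
    [MeasurableSingletonClass B] (ν₁ ν₂ : Measure (ℤ → B)) [IsFiniteMeasure ν₁]
    [IsFiniteMeasure ν₂] (k : ℕ) (h : ∀ n, k ≤ n → ∀ w, ν₁ (cyl n w) ≤ ν₂ (cyl n w)) :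
    ν₁ ≤ ν₂ := by
  have hcyl : ∀ t ∈ measurableCylinders (fun _ : ℤ => B), ν₁ t ≤ ν₂ t := by
    intro t ht
    obtain ⟨s, S, _, rfl⟩ := (mem_measurableCylinders t).1 ht
    obtain ⟨n, hkn, hsn⟩ := exists_window_superset s k
    have hf : Measurable fun (ζ : ℤ → B) (i : Window n) => ζ i :=
      measurable_pi_lambda _ fun i => measurable_pi_apply _
    rw [measure_eq_sum_inter_fiber ν₁ hf, measure_eq_sum_inter_fiber ν₂ hf]
    refine Finset.sum_le_sum fun c _ => ?_
    rw [preimage_restrict_eq_agree (fun i (ζ : ℤ → B) => ζ i) (Window n) c]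
    -- The window contains the coordinates `s`, so each window cylinder is either inside the given
    -- cylinder or disjoint from it.
    by_cases hc : extend c ∈ cylinder s S
    · have hsub : cyl n (extend c) ⊆ cylinder s S := by
        intro ζ hζ
        rw [mem_cylinder] at hc ⊢
        convert hc using 1
        ext ⟨i, hi⟩
        exact hζ i (hsn hi)
      rw [Set.inter_eq_right.2 hsub]
      exact h n hkn _
    · have hem : cylinder s S ∩ cyl n (extend c) = ∅ := by
        rw [Set.eq_empty_iff_forall_notMem]
        rintro ζ ⟨h1, h2⟩
        refine hc ?_
        rw [mem_cylinder] at h1 ⊢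
        convert h1 using 1
        ext ⟨i, hi⟩
        exact (h2 i (hsn hi)).symm
      rw [hem]; simp
  refine Measure.le_iff.2 fun E hE => ?_
  refine ENNReal.le_of_forall_pos_le_add fun ε hε _ => ?_
  have hε' : (0 : ENNReal) < ε / 2 := by simpa using hε.ne'
  -- Approximating `E` with respect to the sum `ν₁ + ν₂` makes one cylinder good for both measures.
  obtain ⟨t, ht, hlt⟩ := exists_measure_symmDiff_lt_of_generateFrom_isSetRing (μ := ν₁ + ν₂)
    (isSetRing_measurableCylinders (α := fun _ : ℤ => B))
    ⟨{Set.univ}, Set.countable_singleton _, by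
      simpa using univ_mem_measurableCylinders (fun _ : ℤ => B), by simp⟩
    generateFrom_measurableCylinders.symm hE hε'
  rw [Measure.add_apply] at hlt
  have h1 : ν₁ E ≤ ν₁ t + ε / 2 := by
    calc ν₁ E ≤ ν₁ (t ∪ t ∆ E) := measure_mono fun x hx => by
          by_cases hxt : x ∈ t
          · exact Or.inl hxt
          · exact Or.inr (Or.inr ⟨hx, hxt⟩)
      _ ≤ ν₁ t + ν₁ (t ∆ E) := measure_union_le _ _
      _ ≤ ν₁ t + ε / 2 := by gcongr; exact (le_self_add.trans hlt.le)
  have h2 : ν₂ t ≤ ν₂ E + ε / 2 := by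
    calc ν₂ t ≤ ν₂ (E ∪ t ∆ E) := measure_mono fun x hx => by
          by_cases hxt : x ∈ E
          · exact Or.inl hxt
          · exact Or.inr (Or.inl ⟨hx, hxt⟩)
      _ ≤ ν₂ E + ν₂ (t ∆ E) := measure_union_le _ _
      _ ≤ ν₂ E + ε / 2 := by gcongr; exact (le_add_self.trans hlt.le)
  calc ν₁ E ≤ ν₂ E + ε / 2 + ε / 2 := h1.trans (by gcongr; exact (hcyl t ht).trans h2)
    _ = ν₂ E + ε := by rw [add_assoc, ENNReal.add_halves]

end Cylinders

/-! ### Path probabilities, the chain on its support, and the pair kernel -/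

section Chain

variable {Ω A B : Type*} [MeasurableSpace Ω]

/-- The stationary distribution. -/
noncomputable def marginal (μ : Measure Ω) (X : ℤ → Ω → A) (x : A) : ℝ :=
  μ.real {ω | X 0 ω = x}

/-- The one-step transition matrix. -/
noncomputable def trans (μ : Measure Ω) (X : ℤ → Ω → A) (x y : A) : ℝ :=
  (stepProb μ X 1 x y).toReal

variable {μ : Measure Ω} {X : ℤ → Ω → A}

lemma trans_nonneg (x y : A) : 0 ≤ trans μ X x y := ENNReal.toReal_nonneg

lemma marginal_nonneg (x : A) : 0 ≤ marginal μ X x := measureReal_nonneg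

lemma marginal_ne_zero_iff [IsFiniteMeasure μ] (x : A) :
    marginal μ X x ≠ 0 ↔ 0 < μ {ω | X 0 ω = x} := by
  rw [marginal, measureReal_def, ENNReal.toReal_ne_zero, pos_iff_ne_zero]
  exact and_iff_left (measure_ne_top _ _)

variable [MeasurableSpace A] [MeasurableSingletonClass A]

lemma measurableSet_coord (t : ℤ) (x : A) : MeasurableSet {ζ : ℤ → A | ζ t = x} := by
  have h : Measurable fun ζ : ℤ → A => ζ t := measurable_pi_apply t
  exact h (measurableSet_singleton x)

variable [IsProbabilityMeasure μ]

omit [MeasurableSingletonClass A] [IsProbabilityMeasure μ] in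
lemma IsStationary.measureReal_eq (hs : IsStationary μ X) (hm : ∀ i, Measurable (X i)) (s : ℤ)
    {E : Set (ℤ → A)} (hE : MeasurableSet E) :
    μ.real {ω | (fun i => X (i + s) ω) ∈ E} = μ.real {ω | (fun i => X i ω) ∈ E} := by
  have h := congrArg (fun ν => ν E) (hs s)
  beta_reduce at h
  rw [Measure.map_apply (measurable_pi_lambda _ fun i => hm _) hE,
    Measure.map_apply (measurable_pi_lambda _ fun i => hm _) hE] at h
  exact congrArg ENNReal.toReal h

omit [IsProbabilityMeasure μ] in
lemma measureReal_coord (hX : IsErgodicMarkovChain μ X) (t : ℤ) (x : A) :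
    μ.real {ω | X t ω = x} = marginal μ X x := by
  have := hX.stationary.measureReal_eq hX.measurable t (measurableSet_coord 0 x)
  simpa [marginal] using this

lemma measureReal_pair (hX : IsErgodicMarkovChain μ X) (t : ℤ) (n : ℕ) (x y : A) :
    μ.real ({ω | X t ω = x} ∩ {ω | X (t + n) ω = y})
      = marginal μ X x * (stepProb μ X n x y).toReal := by
  have hE : MeasurableSet {ζ : ℤ → A | ζ 0 = x ∧ ζ n = y} :=
    (measurableSet_coord 0 x).inter (measurableSet_coord n y)
  have h := hX.stationary.measureReal_eq hX.measurable t hE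
  have h1 : ({ω | X t ω = x} ∩ {ω | X (t + n) ω = y})
      = {ω | (fun i => X (i + t) ω) ∈ {ζ : ℤ → A | ζ 0 = x ∧ ζ n = y}} := by
    ext ω; simp [add_comm]
  have h2 : {ω | (fun i => X i ω) ∈ {ζ : ℤ → A | ζ 0 = x ∧ ζ n = y}}
      = {ω | X 0 ω = x} ∩ {ω | X n ω = y} := by
    ext ω; simp
  have hm : MeasurableSet {ω | X 0 ω = x} := hX.measurable 0 (measurableSet_singleton x)
  rw [h1, h, h2, marginal, stepProb, cond_apply hm, ENNReal.toReal_mul, ENNReal.toReal_inv]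
  change μ.real _ = μ.real _ * ((μ.real _)⁻¹ * μ.real _)
  rcases eq_or_ne (μ.real {ω | X 0 ω = x}) 0 with h0 | h0
  · rw [h0, zero_mul]
    exact measureReal_mono_null Set.inter_subset_left h0
  · rw [mul_inv_cancel_left₀ h0]

lemma measureReal_agree_inter_next (hX : IsErgodicMarkovChain μ X) (n : ℕ) (t : ℤ)
    (x : ℤ → A) (y : A) :
    μ.real (agree X (Finset.Icc (t - n) t) x ∩ {ω | X (t + 1) ω = y})
      = μ.real (agree X (Finset.Icc (t - n) t) x) * trans μ X (x t) y := by
  set H := agree X (Finset.Icc (t - n) t) x with hH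
  have hHm : MeasurableSet H := measurableSet_agree hX.measurable _ _
  rcases eq_or_ne (μ H) 0 with h0 | h0
  · have h0' : μ.real H = 0 := by rw [measureReal_def, h0]; rfl
    rw [h0', zero_mul]
    exact measureReal_mono_null Set.inter_subset_left h0'
  · have hsub : H ⊆ {ω | X t ω = x t} := fun ω hω => hω t (by rw [Finset.mem_Icc]; omega)
    have hm : MeasurableSet {ω | X t ω = x t} :=
      hX.measurable t (measurableSet_singleton _)
    have h0' : μ.real H ≠ 0 := by
      rw [measureReal_def]; exact ENNReal.toReal_ne_zero.2 ⟨h0, measure_ne_top _ _⟩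
    have hpos : μ.real {ω | X t ω = x t} ≠ 0 := fun h => h0' (measureReal_mono_null hsub h)
    have h := congrArg ENNReal.toReal (hX.markov t n x h0 y)
    rw [cond_apply hHm, cond_apply hm, ENNReal.toReal_mul, ENNReal.toReal_mul, ENNReal.toReal_inv,
      ENNReal.toReal_inv] at h
    change (μ.real _)⁻¹ * μ.real _ = (μ.real _)⁻¹ * μ.real _ at h
    have hp := measureReal_pair hX t 1 (x t) y
    rw [Nat.cast_one] at hp
    rw [hp, measureReal_coord hX, inv_mul_cancel_left₀ (by rwa [← measureReal_coord hX t])] at h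
    rw [trans, ← h, mul_inv_cancel_left₀ h0']

lemma measureReal_path (hX : IsErgodicMarkovChain μ X) (n : ℕ) (s t : ℤ) (h : t = s + n)
    (c : ℤ → A) :
    μ.real (agree X (Finset.Icc s t) c)
      = marginal μ X (c s) * ∏ i ∈ Finset.range n, trans μ X (c (s + i)) (c (s + i + 1)) := by
  induction n generalizing t with
  | zero =>
    have : t = s := by simpa using h
    subst this
    rw [Finset.Icc_self, Finset.prod_range_zero, mul_one, ← measureReal_coord hX t]
    congr 1; ext ω; simp [agree]
  | succ n ih =>
    have hs : agree X (Finset.Icc s t) c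
        = agree X (Finset.Icc (s + n - n) (s + n)) c ∩ {ω | X (s + n + 1) ω = c (s + n + 1)} := by
      ext ω
      simp only [agree, Finset.mem_Icc, Set.mem_inter_iff, Set.mem_ofPred_eq]
      constructor
      · exact fun hω => ⟨fun i hi => hω i (by push_cast at h; omega), hω _ (by push_cast at h; omega)⟩
      · rintro ⟨h1, h2⟩ i hi
        rcases eq_or_ne i (s + n + 1) with rfl | hne
        · exact h2
        · exact h1 i (by push_cast at h; omega)
    rw [hs, measureReal_agree_inter_next hX, add_sub_cancel_right, ih (s + n) rfl,
      Finset.prod_range_succ, mul_assoc]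

/-- The law of the path on a window, in terms of its law on the next smaller window. -/
lemma measureReal_window_succ (hX : IsErgodicMarkovChain μ X) (n : ℕ) (c : ℤ → A) :
    μ.real (agree X (Window (n + 1)) c) * marginal μ X (c (-n))
      = marginal μ X (c (-n - 1)) * trans μ X (c (-n - 1)) (c (-n)) * trans μ X (c n) (c (n + 1))
        * μ.real (agree X (Window n) c) := by
  -- The larger window is a path of `2 * n + 2` steps; its first and last transitions are split off.
  -- The marginal stays on the left, so no division is needed.
  rw [measureReal_path hX (2 * n + 2) _ _ (by push_cast; ring),
    measureReal_path hX (2 * n) _ _ (by push_cast; ring), Finset.prod_range_succ,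
    Finset.prod_range_succ']
  have e1 : (-((n + 1 : ℕ) : ℤ)) = -n - 1 := by push_cast; ring
  rw [e1]
  have e2 : ∀ i : ℕ, (-(n : ℤ) - 1 + ((i + 1 : ℕ) : ℤ)) = -n + i := fun i => by push_cast; ring
  simp only [e2]
  have e3 : (-(n : ℤ) - 1 + ((0 : ℕ) : ℤ)) = -n - 1 := by push_cast; ring
  have e4 : (-(n : ℤ) + ((2 * n : ℕ) : ℤ)) = n := by push_cast; ring
  rw [e3, e4, sub_add_cancel]
  ring

variable [Fintype A] [Nonempty A]

/-- A proportionality that holds conditionally on every word of `X` on `I`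
holds conditionally on every event that depends on this word. -/
lemma measureReal_inter_eq_mul (hX : ∀ i, Measurable (X i)) (I : Finset ℤ)
    (Φ : (ℤ → A) → Prop) (hΦ : ∀ c c', (∀ i ∈ I, c i = c' i) → Φ c → Φ c') (G₁ G₂ : Set Ω) (C : ℝ)
    (h : ∀ c, Φ c → μ.real (agree X I c ∩ G₁) = C * μ.real (agree X I c ∩ G₂)) :
    μ.real ({ω | Φ fun i => X i ω} ∩ G₁) = C * μ.real ({ω | Φ fun i => X i ω} ∩ G₂) := by
  rw [measureReal_eq_sum_agree μ hX I, measureReal_eq_sum_agree μ hX I (_ ∩ G₂), Finset.mul_sum]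
  refine Finset.sum_congr rfl fun c _ => ?_
  by_cases hc : Φ (extend c)
  · have : ∀ G, {ω | Φ fun i => X i ω} ∩ G ∩ agree X I (extend c) = agree X I (extend c) ∩ G := by
      intro G
      ext ω
      constructor
      · exact fun hω => ⟨hω.2, hω.1.2⟩
      · exact fun hω => ⟨⟨hΦ _ _ (fun i hi => (hω.1 i hi).symm) hc, hω.2⟩, hω.1⟩
    rw [this, this, h _ hc]
  · have : ∀ G, {ω | Φ fun i => X i ω} ∩ G ∩ agree X I (extend c) = ∅ := by
      intro G
      rw [Set.eq_empty_iff_forall_notMem]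
      exact fun ω hω => hc (hΦ _ _ hω.2 hω.1.1)
    rw [this, this]; simp

/-- The states that are taken with positive probability. -/
abbrev Support (μ : Measure Ω) (X : ℤ → Ω → A) : Type _ := {x : A // marginal μ X x ≠ 0}

noncomputable instance (μ : Measure Ω) (X : ℤ → Ω → A) : Fintype (Support μ X) :=
  Fintype.ofFinite _

noncomputable instance (μ : Measure Ω) (X : ℤ → Ω → A) : DecidableEq (Support μ X) :=
  Classical.decEq _

omit [MeasurableSpace A] [MeasurableSingletonClass A] [IsProbabilityMeasure μ] [Nonempty A] in
-- Primitivity is available only on the support, so null letters have to be removed from every sum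
-- over states.
lemma sum_eq_sum_support (f : A → ℝ) (h : ∀ x, marginal μ X x = 0 → f x = 0) :
    ∑ x, f x = ∑ x : Support μ X, f x := by
  classical
  rw [← Finset.sum_subtype (Finset.univ.filter fun x => marginal μ X x ≠ 0) (by simp) f]
  exact (Finset.sum_filter_of_ne (p := fun x => marginal μ X x ≠ 0)
    fun x _ hx h0 => hx (h x h0)).symm

/-- The transition matrix on the support. -/
noncomputable def transMatrix (μ : Measure Ω) (X : ℤ → Ω → A) :
    Matrix (Support μ X) (Support μ X) ℝ :=
  fun x y => trans μ X x y

/-- Chapman–Kolmogorov in joint form. It carries irreducibility and aperiodicity, which are stated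
for `stepProb`, over to matrix powers. -/
lemma marginal_mul_transMatrix_pow (hX : IsErgodicMarkovChain μ X) (n : ℕ) (x y : Support μ X) :
    marginal μ X x * (transMatrix μ X ^ n) x y
      = μ.real ({ω | X 0 ω = x} ∩ {ω | X n ω = y}) := by
  induction n generalizing y with
  | zero =>
    rw [pow_zero, Matrix.one_apply]
    split_ifs with h
    · subst h; simp [marginal]
    · have : ({ω | X 0 ω = (x : A)} ∩ {ω | X ((0 : ℕ) : ℤ) ω = y}) = ∅ := by
        rw [Set.eq_empty_iff_forall_notMem]
        rintro ω ⟨h1, h2⟩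
        exact h (Subtype.ext (h1.symm.trans h2))
      rw [this]; simp
  | succ n ih =>
    have hm : Measurable (X n) := hX.measurable n
    rw [measureReal_eq_sum_inter_fiber μ hm,
      sum_eq_sum_support (μ := μ) (X := X) _ fun z hz => measureReal_mono_null
        Set.inter_subset_right (by rw [← measureReal_coord hX n] at hz; exact hz),
      pow_succ, Matrix.mul_apply, Finset.mul_sum]
    refine Finset.sum_congr rfl fun z _ => ?_
    -- The Markov property conditions on complete histories; summing over those with the given
    -- values at `0` and `n` leaves a condition on these two times only.
    have key := measureReal_inter_eq_mul (μ := μ) hX.measurable (Finset.Icc ((n : ℤ) - n) n)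
      (fun ζ => ζ 0 = x ∧ ζ n = z)
      (fun c c' hc h => by
        rw [← hc 0 (by rw [Finset.mem_Icc]; omega), ← hc n (by rw [Finset.mem_Icc]; omega)]
        exact h)
      {ω | X ((n : ℤ) + 1) ω = y} Set.univ (trans μ X z y) (fun c hc => by
        rw [measureReal_agree_inter_next hX, hc.2, Set.inter_univ, mul_comm])
    have e1 : ({ω | X 0 ω = (x : A)} ∩ {ω | X ((n + 1 : ℕ) : ℤ) ω = y}) ∩ X n ⁻¹' {(z : A)}
        = {ω | X 0 ω = x ∧ X n ω = z} ∩ {ω | X ((n : ℤ) + 1) ω = y} := by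
      ext ω; simp; tauto
    have e2 : {ω | X 0 ω = (x : A) ∧ X n ω = z} ∩ Set.univ
        = {ω | X 0 ω = (x : A)} ∩ {ω | X n ω = z} := by
      ext ω; simp
    rw [e1, key, e2, ← ih, transMatrix]
    ring

lemma transMatrix_pow_eq (hX : IsErgodicMarkovChain μ X) (n : ℕ) (x y : Support μ X) :
    (transMatrix μ X ^ n) x y = (stepProb μ X n x y).toReal := by
  have h1 := marginal_mul_transMatrix_pow hX n x y
  have h2 := measureReal_pair hX 0 n x y
  rw [zero_add] at h2
  exact mul_left_cancel₀ x.2 (h1.trans h2)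

lemma transMatrix_pow_pos_iff (hX : IsErgodicMarkovChain μ X) (n : ℕ) (x y : Support μ X) :
    0 < (transMatrix μ X ^ n) x y ↔ 0 < stepProb μ X n x y := by
  rw [transMatrix_pow_eq hX, ENNReal.toReal_pos_iff]
  exact and_iff_left (measure_lt_top _ _)

lemma transMatrix_pow_le_one (hX : IsErgodicMarkovChain μ X) (n : ℕ) (x y : Support μ X) :
    (transMatrix μ X ^ n) x y ≤ 1 := by
  rw [transMatrix_pow_eq hX]
  have : IsProbabilityMeasure (μ[|{ω | X 0 ω = (x : A)}]) :=
    cond_isProbabilityMeasure ((marginal_ne_zero_iff _).1 x.2).ne'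
  exact ENNReal.toReal_mono ENNReal.one_ne_top prob_le_one

lemma exists_transMatrix_pow_pos (hX : IsErgodicMarkovChain μ X) :
    ∃ m, 0 < m ∧ ∀ x y, 0 < (transMatrix μ X ^ m) x y := by
  refine exists_pow_pos (fun x y => trans_nonneg _ _) (fun x y => ?_) fun x d hd => ?_
  · obtain ⟨n, hn⟩ := hX.irreducible x y ((marginal_ne_zero_iff _).1 x.2)
      ((marginal_ne_zero_iff _).1 y.2)
    exact ⟨n, (transMatrix_pow_pos_iff hX n x y).2 hn⟩
  · exact hX.aperiodic x ((marginal_ne_zero_iff _).1 x.2) d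
      fun n hn h => hd n hn ((transMatrix_pow_pos_iff hX n x x).2 h)

/-- The kernel that extends a window by one step on both sides. -/
noncomputable def pairMatrix (μ : Measure Ω) (X : ℤ → Ω → A) :
    Matrix (Support μ X × Support μ X) (Support μ X × Support μ X) ℝ :=
  fun p q => transMatrix μ X p.1 q.1 * transMatrix μ X q.2 p.2

omit [MeasurableSpace A] [MeasurableSingletonClass A] [IsProbabilityMeasure μ] [Nonempty A] in
-- The kernel is the tensor product of the transition matrix and its transpose, so powers factor and
-- primitivity is inherited.
lemma pairMatrix_pow (n : ℕ) (p q : Support μ X × Support μ X) :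
    (pairMatrix μ X ^ n) p q = (transMatrix μ X ^ n) p.1 q.1 * (transMatrix μ X ^ n) q.2 p.2 := by
  induction n generalizing q with
  | zero =>
    simp only [pow_zero, Matrix.one_apply, Prod.ext_iff, eq_comm (a := q.2)]
    split_ifs <;> simp_all
  | succ n ih =>
    have h1 := congrFun (congrFun (pow_succ (transMatrix μ X) n) p.1) q.1
    have h2 := congrFun (congrFun (pow_succ' (transMatrix μ X) n) q.2) p.2
    rw [Matrix.mul_apply] at h1 h2
    rw [pow_succ, Matrix.mul_apply, h1, h2, Finset.sum_mul_sum, Fintype.sum_prod_type]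
    refine Finset.sum_congr rfl fun a _ => Finset.sum_congr rfl fun b _ => ?_
    rw [ih, pairMatrix]
    ring

end Chain

/-! ### The recursion for joint probabilities and the posterior interval -/

section HiddenMarkov

lemma agree_congr {Ω B : Type*} {I : Finset ℤ} {Y : ℤ → Ω → B} {w z : ℤ → B} (h : ∀ i ∈ I, w i = z i) :
    agree Y I w = agree Y I z := by
  ext ω
  exact ⟨fun hω i hi => (hω i hi).trans (h i hi), fun hω i hi => (hω i hi).trans (h i hi).symm⟩

variable {Ω A B : Type*} [MeasurableSpace Ω] [MeasurableSpace A] [MeasurableSingletonClass A]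
  [MeasurableSpace B] {μ : Measure Ω} [IsProbabilityMeasure μ]
  {X : ℤ → Ω → A} {Z : ℤ → Ω → B} {W : A → PMF B}

/-- The probability that the channel outputs `b` on input `a`, as a real number. -/
noncomputable def emission (W : A → PMF B) (a : A) (b : B) : ℝ := (W a b).toReal

omit [MeasurableSpace A] [MeasurableSingletonClass A] [MeasurableSpace B] in
lemma emission_le_one (a : A) (b : B) : emission W a b ≤ 1 :=
  ENNReal.toReal_mono ENNReal.one_ne_top (PMF.coe_le_one _ _)

omit [MeasurableSpace A] [MeasurableSingletonClass A] [MeasurableSpace B] in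
lemma emission_nonneg (a : A) (b : B) : 0 ≤ emission W a b := ENNReal.toReal_nonneg

omit [MeasurableSpace A] [MeasurableSingletonClass A] [MeasurableSpace B] in
lemma emission_pos (hW : ∀ a b, 0 < W a b) (a : A) (b : B) : 0 < emission W a b :=
  ENNReal.toReal_pos (hW a b).ne' (PMF.apply_ne_top _ _)

omit [MeasurableSpace A] [MeasurableSingletonClass A] [IsProbabilityMeasure μ] in
lemma measureReal_agree_inter_agree (hZ : IsChannelOutput μ W X Z) (I : Finset ℤ) (x : ℤ → A)
    (z : ℤ → B) :
    μ.real (agree X I x ∩ agree Z I z)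
      = μ.real (agree X I x) * ∏ i ∈ I, emission W (x i) (z i) := by
  rw [measureReal_def, hZ.memoryless, ENNReal.toReal_mul, ENNReal.toReal_prod]
  rfl

lemma window_succ (n : ℕ) :
    Window (n + 1) = insert (-(n : ℤ) - 1) (insert ((n : ℤ) + 1) (Window n)) := by
  ext i
  simp only [Finset.mem_insert, Finset.mem_Icc]
  push_cast
  omega

lemma prod_window_succ (n : ℕ) (f : ℤ → ℝ) :
    ∏ i ∈ Window (n + 1), f i = f (-n - 1) * (f (n + 1) * ∏ i ∈ Window n, f i) := by
  rw [window_succ, Finset.prod_insert, Finset.prod_insert]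
  · simp
  · simp only [Finset.mem_insert, Finset.mem_Icc]; omega

/-- The joint probability of `X_0 ∈ D`, of the values of `X` at the endpoints of a window and of
the observations in that window. -/
noncomputable def jointProb (μ : Measure Ω) (X : ℤ → Ω → A) (Z : ℤ → Ω → B) (D : Set A)
    (z : ℤ → B) (n : ℕ) (a b : A) : ℝ :=
  μ.real ({ω | X 0 ω ∈ D ∧ X (-n) ω = a ∧ X n ω = b} ∩ agree Z (Window n) z)

omit [MeasurableSpace B] in
lemma jointProb_eq_zero (hX : IsErgodicMarkovChain μ X) {D : Set A} {z : ℤ → B} {n : ℕ} {a b : A}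
    (h : marginal μ X a = 0 ∨ marginal μ X b = 0) : jointProb μ X Z D z n a b = 0 := by
  rcases h with h | h
  · rw [← measureReal_coord hX (-n)] at h
    exact measureReal_mono_null (fun ω hω => hω.1.2.1) h
  · rw [← measureReal_coord hX n] at h
    exact measureReal_mono_null (fun ω hω => hω.1.2.2) h

variable [Fintype A] [Nonempty A]

lemma measureReal_extend_window (hX : IsErgodicMarkovChain μ X) (hZ : IsChannelOutput μ W X Z)
    (D : Set A) (z : ℤ → B) (n : ℕ) (a b a' b' : A) (ha' : marginal μ X a' ≠ 0) :
    μ.real ({ω | X 0 ω ∈ D ∧ X (-n) ω = a' ∧ X n ω = b'} ∩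
        ({ω | X (-n - 1) ω = a ∧ X (n + 1) ω = b} ∩ agree Z (Window (n + 1)) z))
      = (marginal μ X a * trans μ X a a' * trans μ X b' b * emission W a (z (-n - 1))
          * emission W b (z (n + 1)) / marginal μ X a') * jointProb μ X Z D z n a' b' := by
  refine measureReal_inter_eq_mul (μ := μ) hX.measurable (Window n)
    (fun ζ => ζ 0 ∈ D ∧ ζ (-n) = a' ∧ ζ n = b') (fun c c' hc h => ?_) _ _ _ fun c hc => ?_
  · rw [← hc 0 (by rw [Finset.mem_Icc]; omega), ← hc n (by rw [Finset.mem_Icc]; omega),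
      ← hc (-n) (by rw [Finset.mem_Icc]; omega)]
    exact h
  · set c' : ℤ → A := fun i => if i = -n - 1 then a else if i = n + 1 then b else c i with hc'
    have h1 : c' (-n - 1) = a := by simp [hc']
    have h2 : c' (n + 1) = b := by
      have : ((n : ℤ) + 1) ≠ -n - 1 := by omega
      simp [hc', this]
    have h3 : ∀ i ∈ Window n, c' i = c i := by
      intro i hi
      rw [Finset.mem_Icc] at hi
      have e1 : i ≠ -n - 1 := by omega
      have e2 : i ≠ n + 1 := by omega
      simp [hc', e1, e2]
    have h4 : agree X (Window n) c ∩
        ({ω | X (-n - 1) ω = a ∧ X (n + 1) ω = b} ∩ agree Z (Window (n + 1)) z)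
        = agree X (Window (n + 1)) c' ∩ agree Z (Window (n + 1)) z := by
      rw [← Set.inter_assoc]
      congr 1
      ext ω
      simp only [agree, window_succ, Finset.forall_mem_insert, Set.mem_inter_iff,
        Set.mem_ofPred_eq, h1, h2]
      constructor
      · rintro ⟨e1, e2, e3⟩
        exact ⟨e2, e3, fun i hi => by rw [h3 i hi]; exact e1 i hi⟩
      · rintro ⟨e2, e3, e1⟩
        exact ⟨fun i hi => by rw [← h3 i hi]; exact e1 i hi, e2, e3⟩
    have h5 : agree X (Window n) c' = agree X (Window n) c := by
      ext ω
      exact ⟨fun h i hi => by rw [← h3 i hi]; exact h i hi,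
        fun h i hi => by rw [h3 i hi]; exact h i hi⟩
    have h6 : ∏ i ∈ Window n, emission W (c' i) (z i) = ∏ i ∈ Window n, emission W (c i) (z i) :=
      Finset.prod_congr rfl fun i hi => by rw [h3 i hi]
    have h7 := measureReal_window_succ hX n c'
    rw [h1, h2, h5, h3 (-n) (by rw [Finset.mem_Icc]; omega),
      h3 n (by rw [Finset.mem_Icc]; omega), hc.2.1, hc.2.2] at h7
    rw [h4, measureReal_agree_inter_agree hZ, measureReal_agree_inter_agree hZ,
      prod_window_succ n fun i => emission W (c' i) (z i), h1, h2, h6, eq_div_of_mul_eq ha' h7]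
    field_simp

/-- The left end is extended backwards, with weight `π(a) P(a, a') / π(a')`. Dividing the joint
probability by the mass of its left endpoint absorbs both marginals and leaves `P(a, a') P(b', b)`.
-/
lemma jointProb_succ (hX : IsErgodicMarkovChain μ X) (hZ : IsChannelOutput μ W X Z)
    (D : Set A) (z : ℤ → B) (n : ℕ) (p : Support μ X × Support μ X) :
    jointProb μ X Z D z (n + 1) p.1 p.2 / marginal μ X p.1
      = emission W p.1 (z (-n - 1)) * emission W p.2 (z (n + 1))
        * (pairMatrix μ X).mulVec
            (fun q => jointProb μ X Z D z n q.1 q.2 / marginal μ X q.1) p := by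
  have hm : ∀ t, Measurable (X t) := hX.measurable
  have hexp : jointProb μ X Z D z (n + 1) p.1 p.2 = ∑ a' : A, ∑ b' : A,
      μ.real ({ω | X 0 ω ∈ D ∧ X (-n) ω = a' ∧ X n ω = b'} ∩
        ({ω | X (-n - 1) ω = p.1 ∧ X (n + 1) ω = p.2} ∩ agree Z (Window (n + 1)) z)) := by
    rw [jointProb, measureReal_eq_sum_inter_fiber μ (hm (-n))]
    refine Finset.sum_congr rfl fun a' _ => ?_
    rw [measureReal_eq_sum_inter_fiber μ (hm n)]
    refine Finset.sum_congr rfl fun b' _ => ?_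
    congr 1
    have e1 : -((n : ℤ) + 1) = -n - 1 := by ring
    have e2 : (((n + 1 : ℕ) : ℤ)) = n + 1 := by push_cast; ring
    ext ω
    simp only [e2, e1, Set.mem_inter_iff, Set.mem_ofPred_eq, Set.mem_preimage,
      Set.mem_singleton_iff]
    tauto
  have hnull : ∀ (t : ℤ) (a : A), marginal μ X a = 0 → ∀ E : Set Ω, (∀ ω ∈ E, X t ω = a) →
      μ.real E = 0 := fun t a ha E hE => by
    rw [← measureReal_coord hX t] at ha
    exact measureReal_mono_null hE ha
  rw [hexp, sum_eq_sum_support (μ := μ) (X := X) _ fun a ha => Finset.sum_eq_zero fun b _ =>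
    hnull (-n) a ha _ fun ω hω => hω.1.2.1, Finset.sum_div, Matrix.mulVec, dotProduct,
    Fintype.sum_prod_type, Finset.mul_sum]
  refine Finset.sum_congr rfl fun a' _ => ?_
  rw [sum_eq_sum_support (μ := μ) (X := X) _ fun b hb => hnull n b hb _ fun ω hω => hω.1.2.2,
    Finset.sum_div, Finset.mul_sum]
  refine Finset.sum_congr rfl fun b' _ => ?_
  rw [measureReal_extend_window hX hZ _ _ _ _ _ _ _ a'.2]
  have := p.1.2
  have := a'.2
  simp only [pairMatrix, transMatrix]
  field_simp

omit [MeasurableSpace B] [Nonempty A] in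
lemma measureReal_eq_sum_jointProb (hX : IsErgodicMarkovChain μ X) (D : Set A) (z : ℤ → B)
    (n : ℕ) :
    μ.real ({ω | X 0 ω ∈ D} ∩ agree Z (Window n) z)
      = ∑ a : Support μ X, ∑ b : Support μ X, jointProb μ X Z D z n a b := by
  rw [measureReal_eq_sum_inter_fiber μ (hX.measurable (-n))]
  have : ∀ a, μ.real ({ω | X 0 ω ∈ D} ∩ agree Z (Window n) z ∩ X (-n) ⁻¹' {a})
      = ∑ b : A, jointProb μ X Z D z n a b := by
    intro a
    rw [measureReal_eq_sum_inter_fiber μ (hX.measurable n)]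
    refine Finset.sum_congr rfl fun b _ => ?_
    rw [jointProb]
    congr 1
    ext ω
    simp only [Set.mem_inter_iff, Set.mem_ofPred_eq, Set.mem_preimage, Set.mem_singleton_iff]
    tauto
  simp_rw [this]
  rw [sum_eq_sum_support (μ := μ) (X := X) _ fun a ha => Finset.sum_eq_zero fun b _ =>
    jointProb_eq_zero hX (Or.inl ha)]
  exact Finset.sum_congr rfl fun a _ => sum_eq_sum_support _ fun b hb =>
    jointProb_eq_zero hX (Or.inr hb)

lemma exists_pos_lower_bound {ι : Type*} [Finite ι] (f : ι → ℝ) (hf : ∀ i, 0 < f i) :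
    ∃ q, 0 < q ∧ q ≤ 1 ∧ ∀ i, q ≤ f i := by
  rcases isEmpty_or_nonempty ι with h | h
  · exact ⟨1, one_pos, le_rfl, fun i => h.elim i⟩
  · obtain ⟨i, hi⟩ := Finite.exists_min f
    exact ⟨min 1 (f i), lt_min one_pos (hf i), min_le_left _ _,
      fun j => (min_le_right _ _).trans (hi j)⟩

/-- The posterior probabilities of `X_0` given the observations in windows that contain
`{-k, …, k}` lie in an interval that depends on the observations in `{-k, …, k}` only
and has exponentially small length. -/
theorem exists_posterior_sandwich [Finite B] (hX : IsErgodicMarkovChain μ X)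
    (hZ : IsChannelOutput μ W X Z) (hW : ∀ a b, 0 < W a b) :
    ∃ ρ : ℝ, 0 ≤ ρ ∧ ρ < 1 ∧ ∃ m₀ : ℕ, 0 < m₀ ∧ ∀ (k : ℕ) (x : A) (z : ℤ → B),
      ∃ m M : ℝ, M - m = ρ ^ (k / m₀) ∧ ∀ n, k ≤ n → ∀ w : ℤ → B, (∀ i ∈ Window k, w i = z i) →
        m * μ.real (agree Z (Window n) w) ≤ μ.real ({ω | X 0 ω = x} ∩ agree Z (Window n) w) ∧
        μ.real ({ω | X 0 ω = x} ∩ agree Z (Window n) w) ≤ M * μ.real (agree Z (Window n) w) := by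
  obtain ⟨m₀, hm₀, hpos⟩ := exists_transMatrix_pow_pos hX
  obtain ⟨q, hq0, hq1, hq⟩ := exists_pos_lower_bound
    (fun p : Support μ X × Support μ X => (transMatrix μ X ^ m₀) p.1 p.2) fun p => hpos _ _
  obtain ⟨e, he0, he1, he⟩ := exists_pos_lower_bound
    (fun p : A × B => emission W p.1 p.2) fun p => emission_pos hW _ _
  have hq2 : q * q ≤ 1 := mul_le_one₀ hq1 hq0.le hq1
  have he2 : (e * e) ^ m₀ ≤ 1 := pow_le_one₀ (mul_nonneg he0.le he0.le)
    (mul_le_one₀ he1 he0.le he1)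
  -- Each step contributes two emissions, each at least `e`; an entry of the `m₀`-th power of the
  -- pair kernel is a product of two entries, each at least `q`.
  refine ⟨1 - (e * e) ^ m₀ * (q * q), ?_, ?_, m₀, hm₀, fun k x z => ?_⟩
  · have := mul_le_one₀ he2 (by positivity) hq2
    linarith
  · have : 0 < (e * e) ^ m₀ * (q * q) := by positivity
    linarith
  let v : Set A → (ℤ → B) → ℕ → Support μ X × Support μ X → ℝ := fun D z n p =>
    jointProb μ X Z D z n p.1 p.2 / marginal μ X p.1
  let d : (ℤ → B) → ℕ → Support μ X × Support μ X → ℝ := fun z n p =>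
    emission W p.1 (z (-n - 1)) * emission W p.2 (z (n + 1))
  have hv : ∀ D z k s, v D z (k + 1) s = d z k s * ((pairMatrix μ X).mulVec (v D z k)) s :=
    fun D z k s => jointProb_succ hX hZ D z k s
  have hP : ∀ s t, 0 ≤ pairMatrix μ X s t := fun s t =>
    mul_nonneg (trans_nonneg _ _) (trans_nonneg _ _)
  have hd0 : ∀ z k s, 0 ≤ d z k s := fun z k s =>
    mul_nonneg (emission_nonneg _ _) (emission_nonneg _ _)
  obtain ⟨m, M, hmM, hb⟩ := exists_sandwich hP (m₀ := m₀) (q := q * q) (w := e * e)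
    (by positivity)
    (fun s t => by
      rw [pairMatrix_pow]
      exact mul_le_mul (hq (s.1, t.1)) (hq (t.2, s.2)) hq0.le (hpos _ _).le)
    (fun s t => by
      rw [pairMatrix_pow]
      exact mul_le_one₀ (transMatrix_pow_le_one hX _ _ _) (hpos _ _).le
        (transMatrix_pow_le_one hX _ _ _))
    (by positivity) (d := d z)
    (fun k s => mul_le_mul (he (s.1, _)) (he (s.2, _)) he0.le (emission_nonneg _ _))
    (fun k s => mul_le_one₀ (emission_le_one _ _) (emission_nonneg _ _) (emission_le_one _ _))
    (hv {x} z) (hv Set.univ z)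
    (fun s => ⟨div_nonneg measureReal_nonneg (marginal_nonneg _),
      div_le_div_of_nonneg_right (measureReal_mono fun ω hω => ⟨⟨trivial, hω.1.2⟩, hω.2⟩)
        (marginal_nonneg _)⟩) k
  refine ⟨m, M, hmM, fun n hkn w hw => ?_⟩
  -- Up to time `k` only the observations in the inner window enter, so the interval found for `z`
  -- also serves `w`.
  have hvw : ∀ D, v D z k = v D w k := by
    intro D
    ext p
    simp only [v, jointProb]
    rw [agree_congr hw]
  rw [hvw, hvw] at hb
  have hb' := sandwich_mono hP (hd0 w) (hv {x} w) (hv Set.univ w) hkn hb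
  have hb'' : ∀ a b : Support μ X,
      m * jointProb μ X Z Set.univ w n a b ≤ jointProb μ X Z {x} w n a b ∧
      jointProb μ X Z {x} w n a b ≤ M * jointProb μ X Z Set.univ w n a b := by
    intro a b
    have hpa : 0 < marginal μ X a := lt_of_le_of_ne (marginal_nonneg _) a.2.symm
    have := hb' (a, b)
    simp only [v] at this
    rwa [← mul_div_assoc, ← mul_div_assoc, div_le_div_iff_of_pos_right hpa,
      div_le_div_iff_of_pos_right hpa] at this
  have e1 : μ.real (agree Z (Window n) w)
      = μ.real ({ω | X 0 ω ∈ Set.univ} ∩ agree Z (Window n) w) := by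
    congr 1; ext ω; simp
  have e2 : μ.real ({ω | X 0 ω = x} ∩ agree Z (Window n) w)
      = μ.real ({ω | X 0 ω ∈ ({x} : Set A)} ∩ agree Z (Window n) w) := rfl
  rw [e1, e2, measureReal_eq_sum_jointProb hX, measureReal_eq_sum_jointProb hX]
  simp only [Finset.mul_sum]
  exact ⟨Finset.sum_le_sum fun a _ => Finset.sum_le_sum fun b _ => (hb'' a b).1,
    Finset.sum_le_sum fun a _ => Finset.sum_le_sum fun b _ => (hb'' a b).2⟩

end HiddenMarkov

/-! ### From finite windows to the full posterior and the essential supremum -/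

section Posterior

variable {Ω A B : Type*} [MeasurableSpace Ω] [MeasurableSpace A] [MeasurableSingletonClass A]
  [Fintype A] [Nonempty A] [MeasurableSpace B] [MeasurableSingletonClass B] [Fintype B]
  {μ : Measure Ω} [IsProbabilityMeasure μ]
  {X : ℤ → Ω → A} {Z : ℤ → Ω → B} {W : A → PMF B}

omit [MeasurableSingletonClass B] in
/-- Changing the observations in a window changes the probability of a word by at most a constant
factor. -/
lemma exists_mul_measureReal_agree_le (hX : ∀ i, Measurable (X i)) (hZ : IsChannelOutput μ W X Z)
    (hW : ∀ a b, 0 < W a b) (k : ℕ) :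
    ∃ c : ℝ, 0 < c ∧ ∀ n, k ≤ n → ∀ w w' : ℤ → B, (∀ i ∉ Window k, w i = w' i) →
      c * μ.real (agree Z (Window n) w') ≤ μ.real (agree Z (Window n) w) := by
  obtain ⟨e, he0, he1, he⟩ := exists_pos_lower_bound
    (fun p : A × B => emission W p.1 p.2) fun p => emission_pos hW _ _
  refine ⟨e ^ (Window k).card, pow_pos he0 _, fun n hkn w w' hw => ?_⟩
  have hsub : Window k ⊆ Window n := Finset.Icc_subset_Icc (by omega) (by omega)
  rw [measureReal_eq_sum_agree μ hX (Window n), measureReal_eq_sum_agree μ hX (Window n)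
    (agree Z _ w), Finset.mul_sum]
  refine Finset.sum_le_sum fun x _ => ?_
  rw [Set.inter_comm, Set.inter_comm (agree Z _ w), measureReal_agree_inter_agree hZ,
    measureReal_agree_inter_agree hZ, ← Finset.prod_sdiff hsub,
    ← Finset.prod_sdiff hsub (f := fun i => emission W _ (w i))]
  have h1 : ∏ i ∈ Window n \ Window k, emission W (extend x i) (w' i)
      = ∏ i ∈ Window n \ Window k, emission W (extend x i) (w i) :=
    Finset.prod_congr rfl fun i hi => by rw [hw i (Finset.mem_sdiff.1 hi).2]
  have h2 : ∏ i ∈ Window k, emission W (extend x i) (w' i) ≤ 1 :=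
    Finset.prod_le_one (fun i _ => emission_nonneg _ _) fun i _ => emission_le_one _ _
  have h3 : e ^ (Window k).card ≤ ∏ i ∈ Window k, emission W (extend x i) (w i) := by
    rw [← Finset.prod_const]
    exact Finset.prod_le_prod (fun _ _ => he0.le) fun i _ => he (_, _)
  have h4 : e ^ (Window k).card * ∏ i ∈ Window k, emission W (extend x i) (w' i)
      ≤ ∏ i ∈ Window k, emission W (extend x i) (w i) :=
    (mul_le_of_le_one_right (pow_pos he0 _).le h2).trans h3
  have h5 : 0 ≤ μ.real (agree X (Window n) (extend x)) *
      ∏ i ∈ Window n \ Window k, emission W (extend x i) (w i) :=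
    mul_nonneg measureReal_nonneg (Finset.prod_nonneg fun i _ => emission_nonneg _ _)
  have h6 := mul_le_mul_of_nonneg_left h4 h5
  rw [h1]
  linarith

lemma measureReal_agree_pos [Nonempty B] (hX : ∀ i, Measurable (X i))
    (hZ : IsChannelOutput μ W X Z) (hW : ∀ a b, 0 < W a b) (k : ℕ) (z : ℤ → B) :
    0 < μ.real (agree Z (Window k) z) := by
  obtain ⟨c, hc, h⟩ := exists_mul_measureReal_agree_le hX hZ hW k
  refine lt_of_le_of_ne measureReal_nonneg fun h0 => ?_
  -- If one word had probability zero, every word on the window would, contradicting total mass one.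
  have hz : ∀ w : Window k → B, μ.real (agree Z (Window k) (extend w)) = 0 := by
    intro w
    have h1 := h k le_rfl (fun i => if i ∈ Window k then z i else extend w i) (extend w)
      (fun i hi => by rw [if_neg hi])
    have h2 : agree Z (Window k) (fun i => if i ∈ Window k then z i else extend w i)
        = agree Z (Window k) z := agree_congr fun i hi => if_pos hi
    rw [h2, ← h0] at h1
    exact le_antisymm (nonpos_of_mul_nonpos_right h1 hc) measureReal_nonneg
  have hone := measureReal_eq_sum_agree μ hZ.measurable (Window k) Set.univ
  simp only [Set.univ_inter, hz, Finset.sum_const_zero, probReal_univ] at hone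
  exact one_ne_zero hone

omit [MeasurableSpace Ω] [MeasurableSpace A] [MeasurableSingletonClass A] [Fintype A] [Nonempty A]
  [Fintype B] [MeasurableSingletonClass B] in
lemma measurable_splice (k : ℕ) (z : Window k → B) : Measurable (splice k z) := by
  refine measurable_pi_lambda _ fun i => ?_
  by_cases h : i ∈ Window k
  · simp [splice, h]
  · simp only [splice, h, dif_neg, not_false_eq_true]
    exact measurable_pi_apply i

/-- Overwriting the observations in a window yields a law that is absolutely continuous with
respect to the law of the observations. -/
lemma map_splice_absolutelyContinuous [Nonempty B] (hX : ∀ i, Measurable (X i))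
    (hZ : IsChannelOutput μ W X Z) (hW : ∀ a b, 0 < W a b) (k : ℕ) (z : Window k → B) :
    μ.map (fun ω => splice k z fun i => Z i ω) ≪ μ.map fun ω i => Z i ω := by
  obtain ⟨c, hc, h⟩ := exists_mul_measureReal_agree_le hX hZ hW k
  have hZm : Measurable fun ω i => Z i ω := measurable_pi_lambda _ hZ.measurable
  have hSm : Measurable fun ω => splice k z fun i => Z i ω := (measurable_splice k z).comp hZm
  have : IsFiniteMeasure (μ.map fun ω i => Z i ω) := Measure.isFiniteMeasure_map _ _
  -- The factor counts the possible overwritten words `u`, each costing at most `c⁻¹`.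
  refine Measure.absolutelyContinuous_of_le_smul
    (c := ENNReal.ofReal (Fintype.card (Window k → B) * c⁻¹)) ?_
  have : IsFiniteMeasure (ENNReal.ofReal (Fintype.card (Window k → B) * c⁻¹) •
    μ.map fun ω i => Z i ω) := Measure.smul_finite _ ENNReal.ofReal_ne_top
  refine measure_le_of_cyl _ _ k fun n hkn w => ?_
  have hcm : MeasurableSet (cyl n w) :=
    measurableSet_agree (fun i => measurable_pi_apply i) _ _
  rw [Measure.smul_apply, Measure.map_apply hSm hcm, Measure.map_apply hZm hcm, smul_eq_mul,
    ← ofReal_measureReal, ← ofReal_measureReal, ← ENNReal.ofReal_mul' measureReal_nonneg]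
  refine ENNReal.ofReal_le_ofReal ?_
  have hpre : (fun ω i => Z i ω) ⁻¹' cyl n w = agree Z (Window n) w := rfl
  rw [hpre, measureReal_eq_sum_agree μ hZ.measurable (Window k), mul_assoc, ← nsmul_eq_mul,
    ← Finset.card_univ, ← Finset.sum_const]
  refine Finset.sum_le_sum fun u _ => ?_
  have h1 := h n hkn w (splice k u w) fun i hi => by simp only [splice, hi, dif_neg,
    not_false_eq_true]
  rw [inv_mul_eq_div, le_div_iff₀' hc]
  refine le_trans (mul_le_mul_of_nonneg_left (measureReal_mono ?_) hc.le) h1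
  rintro ω ⟨h2, h3⟩ i hi
  by_cases hk : i ∈ Window k
  · rw [h3 i hk, extend_of_mem u hk]
    simp only [splice, hk, dif_pos]
  · have h4 := h2 i hi
    simp only [splice, hk, dif_neg, not_false_eq_true] at h4 ⊢
    exact h4

/-- Bounds on the posterior probability of `X_0` given the observations in large windows pass to
the posterior probability given all observations. -/
lemma ae_fullPosterior_mem_Icc [Nonempty B] (hX : ∀ i, Measurable (X i))
    (hZ : ∀ i, Measurable (Z i)) (k : ℕ) (x : A) (z : ℤ → B) {m M : ℝ} (hM : 0 ≤ M)
    (h : ∀ n, k ≤ n → ∀ w : ℤ → B, (∀ i ∈ Window k, w i = z i) →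
      m * μ.real (agree Z (Window n) w) ≤ μ.real ({ω | X 0 ω = x} ∩ agree Z (Window n) w) ∧
      μ.real ({ω | X 0 ω = x} ∩ agree Z (Window n) w) ≤ M * μ.real (agree Z (Window n) w)) :
    ∀ᵐ ζ ∂(μ.map fun ω i => Z i ω), ζ ∈ cyl k z → fullPosterior μ X Z x ζ ∈ Set.Icc m M := by
  have hZm : Measurable fun ω i => Z i ω := measurable_pi_lambda _ hZ
  set PZ := μ.map fun ω i => Z i ω with hPZ
  have : IsFiniteMeasure PZ := Measure.isFiniteMeasure_map _ _
  have hxm : MeasurableSet {ω | X 0 ω = x} := hX 0 (measurableSet_singleton x)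
  have hcm : ∀ n w, MeasurableSet (cyl (B := B) n w) := fun n w =>
    measurableSet_agree (fun i => measurable_pi_apply i) _ _
  -- On the cylinder the posterior is the density of `ν₁` with respect to `ν₂`, so `m ν₂ ≤ ν₁ ≤ M
  -- ν₂` bounds it almost everywhere.
  set ν₁ := ((μ.restrict {ω | X 0 ω = x}).map fun ω i => Z i ω).restrict (cyl k z) with hν₁
  set ν₂ := PZ.restrict (cyl k z) with hν₂
  have hν₁a : ∀ E, MeasurableSet E → ν₁ E =
      μ ({ω | X 0 ω = x} ∩ (fun ω i => Z i ω) ⁻¹' (E ∩ cyl k z)) := by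
    intro E hE
    rw [hν₁, Measure.restrict_apply hE, Measure.map_apply hZm (hE.inter (hcm k z)),
      Measure.restrict_apply (hZm (hE.inter (hcm k z))), Set.inter_comm]
  have hν₂a : ∀ E, MeasurableSet E → ν₂ E = μ ((fun ω i => Z i ω) ⁻¹' (E ∩ cyl k z)) := by
    intro E hE
    rw [hν₂, Measure.restrict_apply hE, hPZ, Measure.map_apply hZm (hE.inter (hcm k z))]
  have hcases : ∀ n, k ≤ n → ∀ w : ℤ → B, cyl n w ∩ cyl k z = ∅ ∨
      ((∀ i ∈ Window k, w i = z i) ∧ cyl n w ∩ cyl k z = cyl n w) := by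
    intro n hkn w
    have hsub : Window k ⊆ Window n := Finset.Icc_subset_Icc (by omega) (by omega)
    by_cases hw : ∀ i ∈ Window k, w i = z i
    · exact Or.inr ⟨hw, Set.inter_eq_left.2 fun ζ hζ i hi => (hζ i (hsub hi)).trans (hw i hi)⟩
    · refine Or.inl (Set.eq_empty_iff_forall_notMem.2 fun ζ hζ => hw fun i hi => ?_)
      exact (hζ.1 i (hsub hi)).symm.trans (hζ.2 i hi)
  have hup : ν₁ ≤ ENNReal.ofReal M • ν₂ := by
    have : IsFiniteMeasure (ENNReal.ofReal M • ν₂) := Measure.smul_finite _ ENNReal.ofReal_ne_top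
    refine measure_le_of_cyl _ _ k fun n hkn w => ?_
    rw [Measure.smul_apply, hν₁a _ (hcm n w), hν₂a _ (hcm n w), smul_eq_mul]
    rcases hcases n hkn w with h0 | ⟨hw, h0⟩
    · rw [h0]; simp
    · rw [h0, ← ofReal_measureReal, ← ofReal_measureReal,
        ← ENNReal.ofReal_mul' measureReal_nonneg]
      exact ENNReal.ofReal_le_ofReal (h n hkn w hw).2
  have hlow : ENNReal.ofReal m • ν₂ ≤ ν₁ := by
    have : IsFiniteMeasure (ENNReal.ofReal m • ν₂) := Measure.smul_finite _ ENNReal.ofReal_ne_top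
    refine measure_le_of_cyl _ _ k fun n hkn w => ?_
    rw [Measure.smul_apply, hν₁a _ (hcm n w), hν₂a _ (hcm n w), smul_eq_mul]
    rcases hcases n hkn w with h0 | ⟨hw, h0⟩
    · rw [h0]; simp
    · rw [h0, ← ofReal_measureReal, ← ofReal_measureReal,
        ← ENNReal.ofReal_mul' measureReal_nonneg]
      exact ENNReal.ofReal_le_ofReal (h n hkn w hw).1
  have hκm : Measurable fun ζ => condDistrib (X 0) (fun ω i => Z i ω) μ ζ {x} :=
    Kernel.measurable_coe _ (measurableSet_singleton x)
  have hint : ∀ E, MeasurableSet E →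
      ∫⁻ ζ in E, condDistrib (X 0) (fun ω i => Z i ω) μ ζ {x} ∂ν₂ = ν₁ E := by
    intro E hE
    rw [hν₂, Measure.restrict_restrict hE, hPZ,
      setLIntegral_map (hE.inter (hcm k z)) hκm hZm,
      setLIntegral_preimage_condDistrib hZm (hX 0).aemeasurable (measurableSet_singleton x)
        (hE.inter (hcm k z)), hν₁a E hE, Set.inter_comm]
    rfl
  have hae1 : ∀ᵐ ζ ∂ν₂, condDistrib (X 0) (fun ω i => Z i ω) μ ζ {x} ≤ ENNReal.ofReal M := by
    refine ae_le_of_forall_setLIntegral_le_of_sigmaFinite hκm fun E hE _ => ?_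
    rw [hint E hE, setLIntegral_const]
    exact hup E
  have hae2 : ∀ᵐ ζ ∂ν₂, ENNReal.ofReal m ≤ condDistrib (X 0) (fun ω i => Z i ω) μ ζ {x} := by
    refine ae_le_of_forall_setLIntegral_le_of_sigmaFinite measurable_const fun E hE _ => ?_
    rw [hint E hE, setLIntegral_const]
    exact hlow E
  rw [← ae_restrict_iff' (hcm k z)]
  filter_upwards [hae1, hae2] with ζ h1 h2
  exact ⟨(ENNReal.ofReal_le_iff_le_toReal (measure_ne_top _ _)).1 h2,
    ENNReal.toReal_le_of_le_ofReal hM h1⟩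

/-- Geometric bound on the difference between the posterior given the observations in a window and
the posterior given all observations. -/
theorem exists_ae_iSup_le [Nonempty B] (hX : IsErgodicMarkovChain μ X)
    (hZ : IsChannelOutput μ W X Z) (hW : ∀ a b, 0 < W a b) :
    ∃ ρ : ℝ, 0 ≤ ρ ∧ ρ < 1 ∧ ∃ m₀ : ℕ, 0 < m₀ ∧ ∀ k : ℕ, ∀ᵐ ω ∂μ,
      (⨆ p : A × (Window k → B), |windowPosterior μ X Z k p.1 p.2
        - fullPosterior μ X Z p.1 (splice k p.2 (fun i => Z i ω))|) ≤ ρ ^ (k / m₀) := by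
  obtain ⟨ρ, hρ0, hρ1, m₀, hm₀, H⟩ := exists_posterior_sandwich hX hZ hW
  refine ⟨ρ, hρ0, hρ1, m₀, hm₀, fun k => ?_⟩
  have hp : ∀ p : A × (Window k → B), ∀ᵐ ω ∂μ, |windowPosterior μ X Z k p.1 p.2
      - fullPosterior μ X Z p.1 (splice k p.2 (fun i => Z i ω))| ≤ ρ ^ (k / m₀) := by
    rintro ⟨x, z⟩
    obtain ⟨m, M, hmM, hb⟩ := H k x (extend z)
    have hpos := measureReal_agree_pos hX.measurable hZ hW k (extend z)
    have hk := hb k le_rfl (extend z) fun _ _ => rfl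
    have hM : 0 ≤ M := nonneg_of_mul_nonneg_left (measureReal_nonneg.trans hk.2) hpos
    have hw : windowPosterior μ X Z k x z ∈ Set.Icc m M := by
      have he : {ω | ∀ i : Window k, Z i ω = z i} = agree Z (Window k) (extend z) := by
        rw [← preimage_restrict_eq_agree]
        ext ω
        simp [funext_iff]
      rw [windowPosterior, he, measureReal_def,
        cond_apply (measurableSet_agree hZ.measurable _ _), ENNReal.toReal_mul,
        ENNReal.toReal_inv, Set.inter_comm]
      change (μ.real _)⁻¹ * μ.real _ ∈ _
      rw [inv_mul_eq_div]
      exact ⟨(le_div_iff₀ hpos).2 hk.1, (div_le_iff₀ hpos).2 hk.2⟩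
    have hae := ae_fullPosterior_mem_Icc hX.measurable hZ.measurable k x (extend z) hM hb
    have hSm : Measurable fun ω => splice k z fun i => Z i ω :=
      (measurable_splice k z).comp (measurable_pi_lambda _ hZ.measurable)
    -- The bound holds only almost everywhere for the law of `Z`; absolute continuity permits
    -- evaluation at the spliced sequence.
    have hae' := ae_of_ae_map hSm.aemeasurable
      ((map_splice_absolutelyContinuous hX.measurable hZ hW k z).ae_le hae)
    filter_upwards [hae'] with ω hω
    have hf := hω fun i hi => by
      rw [extend_of_mem z hi]
      simp only [splice, hi, dif_pos]
    rw [abs_le]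
    exact ⟨by linarith [hw.1, hf.2], by linarith [hw.2, hf.1]⟩
  filter_upwards [ae_all_iff.2 hp] with ω hω
  exact ciSup_le hω

omit [MeasurableSpace Ω] [MeasurableSpace A] [MeasurableSingletonClass A] [Fintype A] [Nonempty A]
  [MeasurableSpace B] [MeasurableSingletonClass B] [Fintype B] in
lemma exists_pow_div_le_exp {ρ : ℝ} (hρ0 : 0 ≤ ρ) (hρ1 : ρ < 1) {m₀ : ℕ} (hm₀ : 0 < m₀) :
    ∃ C c : ℝ, 0 < C ∧ 0 < c ∧ ∀ k : ℕ, ρ ^ (k / m₀) ≤ C * Real.exp (-c * k) := by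
  -- The maximum keeps the logarithm meaningful when `ρ = 0`.
  set r := max ρ (1 / 2) with hr
  have hr0 : 0 < r := lt_max_of_lt_right (by norm_num)
  have hr1 : r < 1 := max_lt hρ1 (by norm_num)
  have hlog : Real.log r < 0 := Real.log_neg hr0 hr1
  have hm : (0 : ℝ) < m₀ := by exact_mod_cast hm₀
  refine ⟨Real.exp (-Real.log r), -Real.log r / m₀, Real.exp_pos _,
    div_pos (neg_pos.2 hlog) hm, fun k => ?_⟩
  -- Rounding down in `k / m₀` loses at most one factor `r`, which the constant `exp (-log r)`
  -- restores.
  have hk : (k : ℝ) / m₀ ≤ (k / m₀ : ℕ) + 1 := by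
    rw [div_le_iff₀ hm]
    have : k ≤ (k / m₀ + 1) * m₀ := by
      rw [mul_comm]; exact (Nat.lt_mul_div_succ k hm₀).le
    exact_mod_cast this
  calc ρ ^ (k / m₀) ≤ r ^ (k / m₀) := pow_le_pow_left₀ hρ0 (le_max_left _ _) _
    _ = Real.exp ((k / m₀ : ℕ) * Real.log r) := by
      rw [Real.exp_nat_mul, Real.exp_log hr0]
    _ ≤ Real.exp (-Real.log r + -(-Real.log r / m₀) * k) := by
      refine Real.exp_le_exp.2 ?_
      have e : -Real.log r + -(-Real.log r / m₀) * k = ((k : ℝ) / m₀ - 1) * Real.log r := by ring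
      rw [e]
      exact mul_le_mul_of_nonpos_right (by linarith) hlog.le
    _ = _ := Real.exp_add _ _

omit [MeasurableSpace A] [MeasurableSingletonClass A] [Fintype A] [Nonempty A]
  [MeasurableSpace B] [MeasurableSingletonClass B] [Fintype B] in
-- Over `ℝ` the essential supremum is a limsup in a conditionally complete order, so boundedness on
-- both sides has to be supplied.
lemma essSup_mem_Icc {f : Ω → ℝ} {b : ℝ} (h0 : ∀ ω, 0 ≤ f ω) (hb : ∀ᵐ ω ∂μ, f ω ≤ b) :
    essSup f μ ∈ Set.Icc 0 b := by
  have hbdd : IsBoundedUnder (· ≤ ·) (ae μ) f := ⟨b, hb⟩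
  have hbdd' : IsBoundedUnder (· ≥ ·) (ae μ) f := isBoundedUnder_of ⟨0, h0⟩
  refine ⟨le_limsup_of_le hbdd fun a ha => ?_, limsup_le_of_le hbdd'.isCoboundedUnder_le hb⟩
  obtain ⟨ω, hω⟩ := ha.exists
  exact (h0 ω).trans hω

end Posterior

end DoubleSided

theorem mainTheorem5 {Ω A B : Type*} [MeasurableSpace Ω]
    [Fintype A] [Nonempty A] [MeasurableSpace A] [MeasurableSingletonClass A]
    [Fintype B] [MeasurableSpace B] [MeasurableSingletonClass B]
    (μ : Measure Ω) [IsProbabilityMeasure μ]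
    (X : ℤ → Ω → A) (Z : ℤ → Ω → B) (W : A → PMF B)
    (hX : DoubleSided.IsErgodicMarkovChain μ X)
    (hZ : DoubleSided.IsChannelOutput μ W X Z)
    (hW : ∀ (x : A) (z : B), 0 < W x z) :
    Tendsto (fun k : ℕ => DoubleSided.mixingCoeff μ X Z k) atTop (𝓝 0) ∧
      ∃ C c : ℝ, 0 < C ∧ 0 < c ∧
        ∀ k : ℕ, DoubleSided.mixingCoeff μ X Z k ≤ C * Real.exp (-c * k) := by
  have : Nonempty Ω := nonempty_of_isProbabilityMeasure μ
  have : Nonempty B := ⟨Z 0 (Classical.arbitrary Ω)⟩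
  obtain ⟨ρ, hρ0, hρ1, m₀, hm₀, hae⟩ := DoubleSided.exists_ae_iSup_le hX hZ hW
  obtain ⟨C, c, hC, hc, hexp⟩ := DoubleSided.exists_pow_div_le_exp hρ0 hρ1 hm₀
  have hmem : ∀ k, DoubleSided.mixingCoeff μ X Z k ∈ Set.Icc 0 (ρ ^ (k / m₀)) := fun k =>
    DoubleSided.essSup_mem_Icc (fun ω => Real.iSup_nonneg fun _ => abs_nonneg _) (hae k)
  have hle : ∀ k, DoubleSided.mixingCoeff μ X Z k ≤ C * Real.exp (-c * k) := fun k =>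
    (hmem k).2.trans (hexp k)
  refine ⟨squeeze_zero (fun k => (hmem k).1) hle ?_, C, c, hC, hc, hle⟩
  have hlim : Tendsto (fun k : ℕ => -c * (k : ℝ)) atTop atBot :=
    tendsto_natCast_atTop_atTop.const_mul_atTop_of_neg (neg_neg_of_pos hc)
  simpa using (Real.tendsto_exp_atBot.comp hlim).const_mul C
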